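/- Fix $0\le q_1,q_2\le 1/2$ and let $H_b(x)=-x\log_2 x-(1-x)\log_2(1-x)$. Consider the binary doubly-dirty multiple access channel $$Y=X_1\oplus X_2\oplus S_1\oplus S_2,$$ used $n$ times, where the interference words $S_1^n,S_2^n\in\{0,1\}^n$ are independent with i.i.d. Bernoulli$(1/2)$ entries. User $i$ maps its message $W_i\in\mathcal W_i$ and the whole word $S_i^n$ (known non-causally to encoder $i$ only) to $x_i\in\{0,1\}^n$, and always $\frac1n w_H(x_i)\le q_i$, where $w_H$ is the Hamming weight. The decoder sees only $Y^n$. The rates are $\frac1n\log_2|\mathcal W_i|$. A pair $(R_1,R_2)$ with $R_1,R_2\ge 0$ is achievable if there are codes of every length $n\ge1$ with rates at least $R_1,R_2$, satisfying the input constraints, whose error probability (averaged over independent uniform messages and over $S_1^n,S_2^n$) tends to $0$ as $n\to\infty$; the capacity region is the closure of the set of achievable pairs. Then the capacity region equals $$\{(R_1,R_2): R_1,R_2\ge 0,\ R_1+R_2\le\min\{H_b(q_1),H_b(q_2)\}\}.$$ Moreover, linear coding approaches its corner points. Put $q=\min\{q_1,q_2\}$. For every $\varepsilon>0$ and all sufficiently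 large $n$ there is a binary linear code of length $n$ with a full-rank $m\times n$ parity check matrix $H$ and covering radius at most $nq$, such that $\frac mn\ge \min\{H_b(q_1),H_b(q_2)\}-\varepsilon$, and such that, with $f(v)$ a word of least weight among the words $x$ with $Hx=v$, the following scheme satisfies the input constraints and has error probability $0$: one user encodes its message $v\in\{0,1\}^m$ as $f(v\oplus Hs)$, where $s$ is its own interference word, the other user sends $f(Hs')$, where $s'$ is its own interference word, and the decoder outputs $HY^n$. This holds with either user in the role of the first. -/

import Mathlib

open Filter Topology
open scoped Matrix

namespace DirtyMAC

/-- Binary words of length `n`, i.e. vectors over the two-element field. -/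
abbrev Word (n : ℕ) : Type := Fin n → ZMod 2

/-- The binary entropy function in bits (`Real.logb 2 0 = 0` gives `0 log 0 = 0`). -/
noncomputable def Hb (x : ℝ) : ℝ :=
  -x * Real.logb 2 x - (1 - x) * Real.logb 2 (1 - x)

/-- The channel `Y = X₁ ⊕ X₂ ⊕ S₁ ⊕ S₂`, used `n` times. -/
def channel {n : ℕ} (x₁ x₂ s₁ s₂ : Word n) : Word n := x₁ + x₂ + s₁ + s₂

/-- The probability of a word of `n` independent Bernoulli(1/2) bits. -/
noncomputable def stateProb {n : ℕ} (_s : Word n) : ℝ := ∏ _i : Fin n, (1 / 2 : ℝ)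

/-- A block code of length `n` with message sets `W₁`, `W₂`.  Each encoder sees its own message
and the whole of its own interference word (non-causal knowledge); the decoder sees only the
channel output. -/
structure Code (n : ℕ) (W₁ W₂ : Type) where
  enc₁ : W₁ → Word n → Word n
  enc₂ : W₂ → Word n → Word n
  dec : Word n → W₁ × W₂

/-- The channel output, given the messages and the interference words. -/
def Code.output {n : ℕ} {W₁ W₂ : Type} (C : Code n W₁ W₂) (w₁ : W₁) (w₂ : W₂)
    (s₁ s₂ : Word n) : Word n :=
  channel (C.enc₁ w₁ s₁) (C.enc₂ w₂ s₂) s₁ s₂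

/-- The input constraints: every transmitted word of user `i` has normalized Hamming weight at
most `qᵢ`. -/
def Code.InputConstraint {n : ℕ} {W₁ W₂ : Type} (C : Code n W₁ W₂) (q₁ q₂ : ℝ) : Prop :=
  (∀ w₁ s₁, (hammingNorm (C.enc₁ w₁ s₁) : ℝ) / n ≤ q₁) ∧
  (∀ w₂ s₂, (hammingNorm (C.enc₂ w₂ s₂) : ℝ) / n ≤ q₂)

/-- The average probability of error: the messages are uniform on `W₁`, `W₂`, the interference
words consist of Bernoulli(1/2) bits, and all of these are independent. -/
noncomputable def Code.errorProb {n : ℕ} {W₁ W₂ : Type} [Fintype W₁] [Fintype W₂]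
    [DecidableEq W₁] [DecidableEq W₂] (C : Code n W₁ W₂) : ℝ :=
  ∑ w₁ : W₁, ∑ w₂ : W₂, ∑ s₁ : Word n, ∑ s₂ : Word n,
    (1 / (Fintype.card W₁ : ℝ)) * (1 / (Fintype.card W₂ : ℝ)) * stateProb s₁ * stateProb s₂ *
      (if C.dec (C.output w₁ w₂ s₁ s₂) = (w₁, w₂) then 0 else 1)

/-- The same code with the roles of the two users exchanged. -/
def Code.swap {n : ℕ} {W₁ W₂ : Type} (C : Code n W₁ W₂) : Code n W₂ W₁ where
  enc₁ := C.enc₂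
  enc₂ := C.enc₁
  dec y := (C.dec y).swap

/-- The rate `(1/n) log₂ |W|` of a message set at block length `n`. -/
noncomputable def rate (n : ℕ) (W : Type) [Fintype W] : ℝ :=
  Real.logb 2 (Fintype.card W) / n

/-- A pair of (nonnegative) rates is achievable under the input constraints `q₁`, `q₂` if there
are codes of every block length with at least these rates, satisfying the constraints, whose
error probability tends to `0`. -/
def Achievable (q₁ q₂ : ℝ) (R : ℝ × ℝ) : Prop :=
  0 ≤ R.1 ∧ 0 ≤ R.2 ∧
  ∃ (M₁ M₂ : ℕ → ℕ) (C : ∀ n, Code n (Fin (M₁ n)) (Fin (M₂ n))),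
    (∀ n, 0 < M₁ n ∧ 0 < M₂ n) ∧
    (∀ n, 0 < n → R.1 ≤ rate n (Fin (M₁ n)) ∧ R.2 ≤ rate n (Fin (M₂ n))) ∧
    (∀ n, (C n).InputConstraint q₁ q₂) ∧
    Tendsto (fun n => (C n).errorProb) atTop (𝓝 0)

/-- The capacity region: the closure of the set of achievable rate pairs. -/
def capacityRegion (q₁ q₂ : ℝ) : Set (ℝ × ℝ) :=
  closure {R | Achievable q₁ q₂ R}

/-- `f` sends each syndrome `v` to a coset leader, i.e. to a word of least Hamming weight among
the words with syndrome `v`.  (Such an `f` exists exactly when `H` has full row rank, i.e. when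
the code `{x | H x = 0}` of length `n` has dimension `n - m`.) -/
def IsCosetLeaderMap {m n : ℕ} (H : Matrix (Fin m) (Fin n) (ZMod 2))
    (f : Word m → Word n) : Prop :=
  ∀ v, H *ᵥ f v = v ∧ ∀ x, H *ᵥ x = v → hammingNorm (f v) ≤ hammingNorm x

/-- The covering radius of the linear code with parity check matrix `H` is at most `r`. -/
def CoveringRadiusLE {m n : ℕ} (H : Matrix (Fin m) (Fin n) (ZMod 2)) (r : ℝ) : Prop :=
  ∀ s : Word n, ∃ c : Word n, H *ᵥ c = 0 ∧ (hammingDist s c : ℝ) ≤ r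

/-- The linear coset (syndrome) code: the messages of user 1 are the syndromes, user 1 sends the
coset leader of `v + H s₁`, user 2 has a single message and sends the coset leader of `H s₂`, and
the decoder computes the syndrome of the output. -/
def syndromeCode {m n : ℕ} (H : Matrix (Fin m) (Fin n) (ZMod 2)) (f : Word m → Word n) :
    Code n (Word m) Unit where
  enc₁ v s₁ := f (v + H *ᵥ s₁)
  enc₂ _ s₂ := f (H *ᵥ s₂)
  dec y := (H *ᵥ y, ())

end DirtyMAC

/-! Converse: with the messages and `s₂` fixed, the pair (channel input of user 1, output)
determines `s₁`. So at most |ball| · |decoding region of `(w₁, w₂)|` words `s₁` are decoded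
correctly. The decoding regions partition the output space, so the success probability is at most
|ball| / (|W₁| |W₂|) (`Code.one_sub_errorProb_mul_le`), with |ball| ≤ `2 ^ (n * Hb q₁)`. Exchanging
the users gives the bound with `q₂`.

Achievability: if user i sends a word of syndrome `vᵢ + H sᵢ`, the interference cancels and the
output has syndrome `v₁ + v₂` (`mulVec_channel_cosetLeader`). The weight constraint holds when each
syndrome has a representative of weight at most `n * min q₁ q₂`.

Such an `H` with m/n near the entropy comes from growing a linear code one generator at a time: for
some generator the uncovered fraction is at least squared down (`exists_uncovered_sup_span`). About
`n - log₂ |ball| + log₂ n` generators push it below `2 ^ (-n)`, hence to zero. -/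

namespace DirtyMAC

/-! ### The binary entropy function -/

theorem Hb_eq_binEntropy (x : ℝ) : Hb x = Real.binEntropy x / Real.log 2 := by
  simp only [Hb, Real.binEntropy, Real.logb, Real.log_inv]
  ring

theorem continuous_Hb : Continuous Hb := by
  have : Hb = fun x => Real.binEntropy x / Real.log 2 := funext Hb_eq_binEntropy
  rw [this]
  exact Real.binEntropy_continuous.div_const _

theorem monotoneOn_Hb : MonotoneOn Hb (Set.Icc 0 2⁻¹) := by
  intro x hx y hy hxy
  rw [Hb_eq_binEntropy, Hb_eq_binEntropy]
  exact div_le_div_of_nonneg_right (Real.binEntropy_strictMonoOn.monotoneOn hx hy hxy)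
    (Real.log_pos one_lt_two).le

/-- Monotonicity on [0, 1/2] lets one covering radius serve both users. -/
theorem min_Hb {q₁ q₂ : ℝ} (hq₁ : 0 ≤ q₁ ∧ q₁ ≤ 1 / 2) (hq₂ : 0 ≤ q₂ ∧ q₂ ≤ 1 / 2) :
    min (Hb q₁) (Hb q₂) = Hb (min q₁ q₂) :=
  (monotoneOn_Hb.map_min ⟨hq₁.1, by linarith [hq₁.2]⟩ ⟨hq₂.1, by linarith [hq₂.2]⟩).symm

/-! ### Hamming balls -/

/-- The words of Hamming weight at most `r`. -/
noncomputable def ball (n : ℕ) (r : ℝ) : Finset (Word n) :=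
  Finset.univ.filter fun x => (hammingNorm x : ℝ) ≤ r

@[simp]
theorem mem_ball {n : ℕ} {r : ℝ} {x : Word n} : x ∈ ball n r ↔ (hammingNorm x : ℝ) ≤ r := by
  simp [ball]

/-- A binary word is determined by its support. -/
noncomputable def wordEquivFinset (n : ℕ) : Word n ≃ Finset (Fin n) where
  toFun x := Finset.univ.filter fun i => x i ≠ 0
  invFun s i := if i ∈ s then 1 else 0
  left_inv x := by
    funext i
    have h : ∀ a : ZMod 2, (if a ≠ 0 then 1 else 0) = a := by decide
    simpa using h (x i)
  right_inv s := by ext i; simp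

theorem card_wordEquivFinset {n : ℕ} (x : Word n) :
    (wordEquivFinset n x).card = hammingNorm x := rfl

theorem card_word (n : ℕ) : Fintype.card (Word n) = 2 ^ n := by simp [Word]

theorem card_hammingNorm_eq (n r : ℕ) :
    (Finset.univ.filter fun x : Word n => hammingNorm x = r).card = n.choose r := by
  have := Finset.card_powersetCard r (Finset.univ : Finset (Fin n))
  rw [Finset.card_univ, Fintype.card_fin] at this
  rw [← this]
  refine Finset.card_bij (fun x _ => wordEquivFinset n x) ?_ ?_ ?_
  · intro x hx
    rw [Finset.mem_powersetCard_univ, card_wordEquivFinset]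
    simpa using hx
  · intro x _ y _ h
    exact (wordEquivFinset n).injective h
  · intro s hs
    refine ⟨(wordEquivFinset n).symm s, ?_, by simp⟩
    rw [Finset.mem_powersetCard_univ] at hs
    rw [Finset.mem_filter, ← card_wordEquivFinset, Equiv.apply_symm_apply]
    exact ⟨Finset.mem_univ _, hs⟩

theorem choose_le_card_ball (n : ℕ) {q : ℝ} (hq : 0 ≤ q) :
    n.choose ⌊q * n⌋₊ ≤ (ball n (n * q)).card := by
  rw [← card_hammingNorm_eq]
  refine Finset.card_le_card fun x hx => ?_
  simp only [Finset.mem_filter, Finset.mem_univ, true_and] at hx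
  rw [mem_ball, hx, mul_comm (n : ℝ)]
  exact Nat.floor_le (by positivity)

/-- The right side is the reciprocal of the Bernoulli(q) probability of a word of (possibly
fractional) weight `n * q`. -/
theorem two_rpow_mul_Hb {q : ℝ} (h0 : 0 < q) (h1 : q < 1) (n : ℝ) :
    (2 : ℝ) ^ (n * Hb q) = (q ^ (n * q) * (1 - q) ^ (n * (1 - q)))⁻¹ := by
  have h1' : 0 < 1 - q := by linarith
  have e1 : q = (2 : ℝ) ^ Real.logb 2 q :=
    (Real.rpow_logb two_pos (by norm_num) h0).symm
  have e2 : 1 - q = (2 : ℝ) ^ Real.logb 2 (1 - q) :=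
    (Real.rpow_logb two_pos (by norm_num) h1').symm
  have a1 : q ^ (n * q) = (2 : ℝ) ^ (Real.logb 2 q * (n * q)) := by
    rw [Real.rpow_mul zero_le_two, ← e1]
  have a2 : (1 - q) ^ (n * (1 - q)) = (2 : ℝ) ^ (Real.logb 2 (1 - q) * (n * (1 - q))) := by
    rw [Real.rpow_mul zero_le_two, ← e2]
  rw [a1, a2, ← Real.rpow_add two_pos, ← Real.rpow_neg zero_le_two, Hb]
  congr 1
  ring

/-- The volume bound for Hamming balls of relative radius at most one half. -/
theorem card_ball_le {n : ℕ} {q : ℝ} (h0 : 0 ≤ q) (h1 : q ≤ 1 / 2) :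
    ((ball n (n * q)).card : ℝ) ≤ 2 ^ (n * Hb q) := by
  rcases h0.eq_or_lt with rfl | h0
  · have : ball n (n * 0) ⊆ {0} := by
      intro x hx
      rw [mem_ball, mul_zero] at hx
      have : hammingNorm x = 0 := by
        have : hammingNorm x ≤ 0 := by exact_mod_cast hx
        omega
      simpa using this
    have := Finset.card_le_card this
    simp only [Finset.card_singleton] at this
    simpa [Hb] using this
  have hq' : 0 < 1 - q := by linarith
  -- The Bernoulli(q) product measure has total mass 1.
  have hsum : ∑ x : Word n, q ^ hammingNorm x * (1 - q) ^ (n - hammingNorm x) = 1 := by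
    have := Fintype.sum_pow_mul_eq_add_pow (Fin n) q (1 - q)
    rw [Fintype.card_fin, add_sub_cancel, one_pow] at this
    rw [← (wordEquivFinset n).sum_comp] at this
    exact this
  -- Since `q / (1 - q) ≤ 1`, probability decreases with weight, so each word of the ball is at
  -- least as likely as one of weight `n * q`.
  have hterm : ∀ x ∈ ball n (n * q),
      q ^ (n * q) * (1 - q) ^ (n * (1 - q)) ≤
        q ^ hammingNorm x * (1 - q) ^ (n - hammingNorm x) := by
    intro x hx
    rw [mem_ball] at hx
    have hle : hammingNorm x ≤ n := by simpa using hammingNorm_le_card_fintype (x := x)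
    have e : (q / (1 - q)) ^ (n * q) ≤ (q / (1 - q)) ^ (hammingNorm x : ℝ) :=
      Real.rpow_le_rpow_of_exponent_ge (by positivity)
        ((div_le_one hq').2 (by linarith)) hx
    rw [Real.div_rpow h0.le hq'.le, Real.div_rpow h0.le hq'.le] at e
    have e2 := mul_le_mul_of_nonneg_right e (Real.rpow_nonneg hq'.le (n : ℝ))
    have f : ∀ a b : ℝ, a / (1 - q) ^ b * (1 - q) ^ (n : ℝ) = a * (1 - q) ^ (n - b) := by
      intro a b
      rw [Real.rpow_sub hq']
      ring
    rw [f, f] at e2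
    rw [← Real.rpow_natCast q, ← Real.rpow_natCast (1 - q), Nat.cast_sub hle]
    have g : (n : ℝ) * (1 - q) = n - n * q := by ring
    rw [g]
    exact e2
  have hpos : 0 < q ^ (n * q) * (1 - q) ^ (n * (1 - q)) := by positivity
  rw [two_rpow_mul_Hb h0 (by linarith), ← one_div, le_div_iff₀ hpos, ← nsmul_eq_mul]
  refine (Finset.card_nsmul_le_sum _ _ _ hterm).trans (le_of_le_of_eq ?_ hsum)
  exact Finset.sum_le_sum_of_subset_of_nonneg (Finset.subset_univ _)
    fun x _ _ => by positivity

/-! ### The largest term of a binomial expansion -/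

/-- The ratio of consecutive terms of `(r + (n - r)) ^ n`, cleared of denominators. -/
theorem choose_mul_pow_succ {n k : ℕ} (r : ℕ) (hk : k < n) :
    (k + 1) * (n - r) * (r ^ (k + 1) * (n - r) ^ (n - (k + 1)) * n.choose (k + 1)) =
      (n - k) * r * (r ^ k * (n - r) ^ (n - k) * n.choose k) := by
  have h := Nat.choose_succ_right_eq n k
  obtain ⟨j, hj⟩ : ∃ j, n - k = j + 1 := ⟨n - k - 1, by omega⟩
  have hj' : n - (k + 1) = j := by omega
  rw [hj']
  rw [hj] at h ⊢
  calc _ = (n - r) * (n - r) ^ j * r ^ (k + 1) * (n.choose (k + 1) * (k + 1)) := by ring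
    _ = _ := by rw [h]; ring

/-- The terms rise up to index `r` and fall afterwards: compare `(k + 1) * (n - r)` with `(n - k) *
r`. -/
theorem choose_mul_pow_le {n r : ℕ} (hr : r < n) {k : ℕ} (hk : k ≤ n) :
    r ^ k * (n - r) ^ (n - k) * n.choose k ≤ r ^ r * (n - r) ^ (n - r) * n.choose r := by
  rcases le_total k r with h | h
  · refine Nat.decreasingInduction' (P := fun k => r ^ k * (n - r) ^ (n - k) * n.choose k ≤
      r ^ r * (n - r) ^ (n - r) * n.choose r) ?_ h le_rfl
    intro j hj _ ih
    refine le_trans ?_ ih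
    have e := choose_mul_pow_succ r (hj.trans hr)
    have hpos : 0 < (j + 1) * (n - r) := Nat.mul_pos j.succ_pos (by omega)
    refine Nat.le_of_mul_le_mul_left ?_ hpos
    rw [e]
    refine Nat.mul_le_mul_right _ ?_
    rw [mul_comm]
    exact Nat.mul_le_mul (by omega) (by omega)
  · induction k, h using Nat.le_induction with
    | base => exact le_rfl
    | succ j hj ih =>
      refine le_trans ?_ (ih (by omega))
      have e := choose_mul_pow_succ r (show j < n by omega)
      have hpos : 0 < (j + 1) * (n - r) := Nat.mul_pos j.succ_pos (by omega)
      refine Nat.le_of_mul_le_mul_left ?_ hpos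
      rw [e]
      refine Nat.mul_le_mul_right _ ?_
      rw [mul_comm]
      exact Nat.mul_le_mul (by omega) (by omega)

/-- The `n + 1` terms of the expansion of `n ^ n` are all bounded by the one of index `r`. -/
theorem pow_self_le_choose {n r : ℕ} (hr : r < n) :
    n ^ n ≤ (n + 1) * (r ^ r * (n - r) ^ (n - r) * n.choose r) := by
  have h := add_pow r (n - r) n
  rw [Nat.add_sub_cancel' hr.le] at h
  rw [h]
  refine (Finset.sum_le_card_nsmul _ _ _ fun k hk =>
    choose_mul_pow_le hr (Nat.lt_succ_iff.1 (Finset.mem_range.1 hk))).trans ?_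
  simp

/-- The entropy lower bound for binomial coefficients. -/
theorem mul_Hb_le_logb_choose {n r : ℕ} (hr : r < n) :
    n * Hb (r / n) ≤ Real.logb 2 (n.choose r) + Real.logb 2 (n + 1) := by
  have hn : (0 : ℝ) < n := by exact_mod_cast (Nat.zero_le r).trans_lt hr
  have hnr : (0 : ℝ) < (n : ℝ) - r := sub_pos.2 (by exact_mod_cast hr)
  have hc : (0 : ℝ) < n.choose r := by exact_mod_cast Nat.choose_pos hr.le
  have h : (n : ℝ) ^ n ≤ (n + 1) * ((r : ℝ) ^ r * ((n : ℝ) - r) ^ (n - r) * n.choose r) := by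
    have := pow_self_le_choose hr
    rw [← Nat.cast_sub hr.le]
    exact_mod_cast this
  have hrr : (0 : ℝ) < (r : ℝ) ^ r := by
    rcases Nat.eq_zero_or_pos r with rfl | h
    · simp
    · positivity
  have hl := Real.logb_le_logb_of_le one_lt_two (by positivity) h
  rw [Real.logb_mul (by positivity) (by positivity), Real.logb_mul (by positivity) hc.ne',
    Real.logb_mul hrr.ne' (by positivity), Real.logb_pow, Real.logb_pow, Real.logb_pow,
    Nat.cast_sub hr.le] at hl
  have e : n * Hb (r / n) = n * Real.logb 2 n - r * Real.logb 2 r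
      - ((n : ℝ) - r) * Real.logb 2 ((n : ℝ) - r) := by
    have e1 : 1 - (r : ℝ) / n = (n - r) / n := by field_simp
    rw [Hb, e1, Real.logb_div hnr.ne' hn.ne']
    rcases Nat.eq_zero_or_pos r with rfl | h
    · simp
    · have : (r : ℝ) ≠ 0 := by positivity
      rw [Real.logb_div this hn.ne']
      field_simp
      ring
  linarith

theorem word_add_self {n : ℕ} (x : Word n) : x + x = 0 :=
  funext fun i => CharTwo.add_self_eq_zero (x i)

/-! ### Good linear covering codes -/

/-- The map `(x, u) ↦ (x, x + u)` carries the counted pairs bijectively onto `U × U`. Thus a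
uniformly random translate meets `U`, on average, in the square of its density. -/
theorem sum_card_filter_add_mem {V : Type*} [AddCommGroup V] [Fintype V] [DecidableEq V]
    (U : Finset V) :
    ∑ u : V, (U.filter fun x => x + u ∈ U).card = U.card * U.card := by
  have h : ∀ x ∈ U, (Finset.univ.filter fun u => x + u ∈ U).card = U.card := by
    intro x _
    refine Finset.card_bij (fun u _ => x + u) (by simp) (by simp) fun y hy => ?_
    exact ⟨y - x, by simpa using hy, by simp⟩
  simp_rw [Finset.card_filter]
  rw [Finset.sum_comm]
  simp_rw [← Finset.card_filter]
  rw [Finset.sum_congr rfl h, Finset.sum_const, smul_eq_mul]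

section Covering

variable {V : Type*} [AddCommGroup V] [Module (ZMod 2) V] [Fintype V] [DecidableEq V]

/-- The points that are not covered by the translates of `B` by elements of `C`. -/
noncomputable def uncovered (B : Finset V) (C : Submodule (ZMod 2) V) : Finset V :=
  open Classical in Finset.univ.filter fun x => ∀ c ∈ C, x + c ∉ B

theorem mem_uncovered {B : Finset V} {C : Submodule (ZMod 2) V} {x : V} :
    x ∈ uncovered B C ↔ ∀ c ∈ C, x + c ∉ B := by
  simp [uncovered]

/-- Adjoining a suitable vector to a linear code squares the uncovered fraction of the space. -/
theorem exists_uncovered_sup_span (B : Finset V) (C : Submodule (ZMod 2) V) :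
    ∃ u : V, Fintype.card V * (uncovered B (C ⊔ Submodule.span (ZMod 2) {u})).card ≤
      (uncovered B C).card ^ 2 := by
  obtain ⟨u, -, hu⟩ := Finset.exists_le_of_sum_le (s := (Finset.univ : Finset V))
    (f := fun u => Fintype.card V * ((uncovered B C).filter fun x => x + u ∈ uncovered B C).card)
    (g := fun _ => (uncovered B C).card ^ 2) ⟨0, Finset.mem_univ _⟩ (by
      rw [← Finset.mul_sum, sum_card_filter_add_mem, Finset.sum_const, Finset.card_univ,
        smul_eq_mul, sq])
  -- If `x` is uncovered after adjoining `u`, then both `x` and `x + u` were uncovered before.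
  refine ⟨u, (Nat.mul_le_mul_left _ (Finset.card_le_card fun x hx => ?_)).trans hu⟩
  rw [mem_uncovered] at hx
  rw [Finset.mem_filter, mem_uncovered, mem_uncovered]
  refine ⟨fun c hc => hx c (Submodule.mem_sup_left hc), fun c hc => ?_⟩
  rw [add_assoc, add_comm u]
  exact hx _ (Submodule.add_mem_sup hc (Submodule.mem_span_singleton_self u))

/-- Iterated squaring from `C = ⊥`, whose uncovered set is the complement of `B`. -/
theorem exists_finrank_le_uncovered (B : Finset V) (k : ℕ) :
    ∃ C : Submodule (ZMod 2) V, Module.finrank (ZMod 2) C ≤ k ∧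
      ((uncovered B C).card : ℝ) / Fintype.card V ≤
        (1 - (B.card : ℝ) / Fintype.card V) ^ 2 ^ k := by
  have hV : (0 : ℝ) < Fintype.card V := by
    exact_mod_cast Fintype.card_pos_iff.2 ⟨(0 : V)⟩
  induction k with
  | zero =>
    refine ⟨⊥, by simp, ?_⟩
    have h : uncovered B ⊥ = Bᶜ := by
      ext x
      simp [mem_uncovered]
    rw [h, Finset.card_compl, Nat.cast_sub (Finset.card_le_univ B), pow_zero, pow_one, sub_div,
      div_self hV.ne']
  | succ k ih =>
    obtain ⟨C, hC, hU⟩ := ih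
    obtain ⟨u, hu⟩ := exists_uncovered_sup_span B C
    refine ⟨C ⊔ Submodule.span (ZMod 2) {u}, ?_, ?_⟩
    · refine (Submodule.finrank_add_le_finrank_add_finrank _ _).trans ?_
      refine Nat.add_le_add hC ?_
      simpa using finrank_span_le_card (R := ZMod 2) ({u} : Set V)
    · rw [pow_succ, pow_mul]
      refine le_trans ?_ (pow_le_pow_left₀ (by positivity) hU 2)
      rw [div_pow, div_le_div_iff₀ hV (by positivity)]
      have hu' : (Fintype.card V : ℝ) * (uncovered B (C ⊔ Submodule.span (ZMod 2) {u})).card ≤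
          (uncovered B C).card ^ 2 := by exact_mod_cast hu
      nlinarith

end Covering

/-- If `2 ^ k` translates of `B` cover the space `n` times in volume, some linear code of
dimension at most `k` covers it with translates of `B`. -/
theorem exists_finrank_le_forall_mem {n k : ℕ} (hn : 0 < n) (B : Finset (Word n))
    (hk : n * 2 ^ n ≤ 2 ^ k * B.card) :
    ∃ C : Submodule (ZMod 2) (Word n), Module.finrank (ZMod 2) C ≤ k ∧
      ∀ x, ∃ c ∈ C, x + c ∈ B := by
  obtain ⟨C, hC, hU⟩ := exists_finrank_le_uncovered B k
  refine ⟨C, hC, fun x => ?_⟩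
  by_contra! hx
  have hmem : x ∈ uncovered B C := mem_uncovered.2 hx
  have hpos : (1 : ℝ) ≤ (uncovered B C).card := by
    exact_mod_cast Finset.card_pos.2 ⟨x, hmem⟩
  rw [card_word] at hU
  push_cast at hU
  have hB : (B.card : ℝ) / 2 ^ n ≤ 1 := by
    rw [div_le_one (by positivity)]
    have := Finset.card_le_univ B
    rw [card_word] at this
    exact_mod_cast this
  have h1 : (1 - (B.card : ℝ) / 2 ^ n) ^ 2 ^ k ≤ Real.exp (-n) := by
    refine (pow_le_pow_left₀ (by linarith) (Real.one_sub_le_exp_neg _) _).trans ?_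
    rw [← Real.exp_nat_mul]
    refine Real.exp_le_exp.2 ?_
    have hk' : (n : ℝ) * 2 ^ n ≤ 2 ^ k * B.card := by exact_mod_cast hk
    have : (n : ℝ) ≤ 2 ^ k * B.card / 2 ^ n := by rwa [le_div_iff₀ (by positivity)]
    push_cast
    rw [mul_neg, mul_div_assoc']
    linarith
  -- As e > 2, the uncovered fraction is less than that of a single point.
  have h2 : Real.exp (-n) < 1 / 2 ^ n := by
    rw [Real.exp_neg, ← one_div]
    refine one_div_lt_one_div_of_lt (by positivity) ?_
    have : (2 : ℝ) < Real.exp 1 := by linarith [Real.exp_one_gt_d9]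
    calc (2 : ℝ) ^ n < Real.exp 1 ^ n := pow_lt_pow_left₀ this zero_le_two hn.ne'
      _ = Real.exp n := by rw [← Real.exp_nat_mul, mul_one]
  have h3 := div_le_div_of_nonneg_right hpos (show (0 : ℝ) ≤ 2 ^ n by positivity)
  linarith

/-- A linear code whose translates of `B` cover the space, described by a parity check matrix. -/
theorem exists_parityCheck_of_card {n k : ℕ} (hn : 0 < n) (B : Finset (Word n))
    (hk : n * 2 ^ n ≤ 2 ^ k * B.card) :
    ∃ (m : ℕ) (H : Matrix (Fin m) (Fin n) (ZMod 2)), n ≤ m + k ∧ ∀ v, ∃ x ∈ B, H *ᵥ x = v := by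
  obtain ⟨C, hC, hcov⟩ := exists_finrank_le_forall_mem hn B hk
  -- The syndrome map is the quotient by `C` in coordinates; covering says that every coset of `C`
  -- meets `B`.
  let e := (Module.finBasis (ZMod 2) (Word n ⧸ C)).equivFun
  let g : Word n →ₗ[ZMod 2] Word (Module.finrank (ZMod 2) (Word n ⧸ C)) :=
    e.toLinearMap ∘ₗ C.mkQ
  refine ⟨_, LinearMap.toMatrix' g, ?_, fun v => ?_⟩
  · have := C.finrank_quotient_add_finrank
    rw [Module.finrank_fin_fun] at this
    omega
  · obtain ⟨x, hx⟩ := C.mkQ_surjective (e.symm v)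
    obtain ⟨c, hc, hB⟩ := hcov x
    refine ⟨x + c, hB, ?_⟩
    rw [LinearMap.toMatrix'_mulVec]
    have hc0 : C.mkQ c = 0 := by simpa using hc
    simp only [g, LinearMap.comp_apply, map_add, hc0, hx]
    simp

/-- The dimension is `⌈log₂ (n 2ⁿ / |ball|)⌉`. The loss is one logarithm from the factor `n` in the
covering bound, one from the binomial estimate, and 1 from the ceiling. -/
theorem exists_parityCheck_of_ball {n : ℕ} (hn : 0 < n) {q : ℝ} (h0 : 0 ≤ q) (h1 : q ≤ 1 / 2) :
    ∃ (m : ℕ) (H : Matrix (Fin m) (Fin n) (ZMod 2)),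
      n * Hb ((⌊q * n⌋₊ : ℝ) / n) - (2 * Real.logb 2 (n + 1) + 1) ≤ m ∧
        ∀ v, ∃ x : Word n, (hammingNorm x : ℝ) ≤ n * q ∧ H *ᵥ x = v := by
  have hn' : (0 : ℝ) < n := by exact_mod_cast hn
  have hr : ⌊q * n⌋₊ < n := by
    rw [Nat.floor_lt (by positivity)]
    nlinarith
  have hch : 0 < n.choose ⌊q * n⌋₊ := Nat.choose_pos hr.le
  have hBch := choose_le_card_ball n h0
  set b := (ball n (n * q)).card with hb
  have hbpos : (0 : ℝ) < b := by exact_mod_cast hch.trans_le hBch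
  have hb2 : (b : ℝ) ≤ 2 ^ n := by
    have := Finset.card_le_univ (ball n (n * q))
    rw [card_word] at this
    exact_mod_cast this
  set y : ℝ := n * 2 ^ n / b with hy
  have hy1 : 1 ≤ y := by
    rw [hy, le_div_iff₀ hbpos]
    have : (1 : ℝ) ≤ n := by exact_mod_cast hn
    nlinarith
  have hypos : 0 < y := by linarith
  have hlogy : Real.logb 2 y = Real.logb 2 n + n - Real.logb 2 b := by
    rw [hy, Real.logb_div (by positivity) hbpos.ne', Real.logb_mul hn'.ne' (by positivity),
      Real.logb_pow, Real.logb_self_eq_one one_lt_two, mul_one]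
  have hk1 : y ≤ 2 ^ ⌈Real.logb 2 y⌉₊ := by
    rw [← Real.rpow_natCast, ← Real.logb_le_iff_le_rpow one_lt_two hypos]
    exact Nat.le_ceil _
  have hk2 := Nat.ceil_lt_add_one (Real.logb_nonneg one_lt_two hy1)
  have hk : n * 2 ^ n ≤ 2 ^ ⌈Real.logb 2 y⌉₊ * b := by
    rw [hy, div_le_iff₀ hbpos, ← hy] at hk1
    exact_mod_cast hk1
  obtain ⟨m, H, hm, hH⟩ := exists_parityCheck_of_card hn _ hk
  refine ⟨m, H, ?_, fun v => ?_⟩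
  · have hm' : (n : ℝ) ≤ m + ⌈Real.logb 2 y⌉₊ := by exact_mod_cast hm
    have e1 := mul_Hb_le_logb_choose hr
    have e2 : Real.logb 2 (n.choose ⌊q * n⌋₊) ≤ Real.logb 2 b :=
      Real.logb_le_logb_of_le one_lt_two (by exact_mod_cast hch) (by exact_mod_cast hBch)
    have e3 : Real.logb 2 n ≤ Real.logb 2 (n + 1) :=
      Real.logb_le_logb_of_le one_lt_two hn' (by linarith)
    linarith
  · obtain ⟨x, hx, hv⟩ := hH v
    exact ⟨x, mem_ball.1 hx, hv⟩

theorem tendsto_Hb_floor_sub {q : ℝ} (h0 : 0 ≤ q) :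
    Tendsto (fun n : ℕ => Hb ((⌊q * n⌋₊ : ℝ) / n) - (2 * Real.logb 2 (n + 1) + 1) / n)
      atTop (𝓝 (Hb q)) := by
  have h1 : Tendsto (fun n : ℕ => (⌊q * n⌋₊ : ℝ) / n) atTop (𝓝 q) :=
    (tendsto_nat_floor_mul_div_atTop h0).comp tendsto_natCast_atTop_atTop
  have h2 : Tendsto (fun n : ℕ => Real.log ((n : ℝ) + 1) / n) atTop (𝓝 0) := by
    -- Taken at `x = n + 1`, the denominator `1 * x + (-1)` is `n`.
    have := (Real.tendsto_pow_log_div_mul_add_atTop 1 (-1) 1 one_ne_zero).comp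
      (tendsto_atTop_add_const_right atTop (1 : ℝ) (tendsto_natCast_atTop_atTop (R := ℝ)))
    refine this.congr fun n => ?_
    simp
  have h3 : Tendsto (fun n : ℕ => (2 * Real.logb 2 (n + 1) + 1) / (n : ℝ)) atTop (𝓝 0) := by
    have := (h2.const_mul (2 / Real.log 2)).add (tendsto_one_div_atTop_nhds_zero_nat (𝕜 := ℝ))
    rw [mul_zero, add_zero] at this
    refine this.congr fun n => ?_
    rw [Real.logb]
    ring
  simpa using (((continuous_Hb.tendsto q).comp h1).sub h3)

/-- Linear covering codes approaching the sphere covering bound. -/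
theorem eventually_exists_parityCheck {q : ℝ} (h0 : 0 ≤ q) (h1 : q ≤ 1 / 2) {ε : ℝ}
    (hε : 0 < ε) :
    ∀ᶠ n : ℕ in atTop, ∃ (m : ℕ) (H : Matrix (Fin m) (Fin n) (ZMod 2)),
      Hb q - ε ≤ m / n ∧ ∀ v, ∃ x : Word n, (hammingNorm x : ℝ) ≤ n * q ∧ H *ᵥ x = v := by
  have := (tendsto_Hb_floor_sub h0).eventually (lt_mem_nhds (show Hb q - ε < Hb q by linarith))
  filter_upwards [this, eventually_gt_atTop 0] with n hn hpos
  obtain ⟨m, H, hm, hH⟩ := exists_parityCheck_of_ball hpos h0 h1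
  refine ⟨m, H, hn.le.trans ?_, hH⟩
  have hpos' : (0 : ℝ) < n := by exact_mod_cast hpos
  rw [le_div_iff₀ hpos', sub_mul, div_mul_cancel₀ _ hpos'.ne']
  linarith

/-- A parity check matrix with minimum weight representatives of the syndromes. -/
theorem exists_isCosetLeaderMap {m n : ℕ} {H : Matrix (Fin m) (Fin n) (ZMod 2)}
    (hH : ∀ v, ∃ x : Word n, H *ᵥ x = v) : ∃ f : Word m → Word n, IsCosetLeaderMap H f := by
  have : ∀ v : Word m, ∃ x : Word n, H *ᵥ x = v ∧
      ∀ y : Word n, H *ᵥ y = v → hammingNorm x ≤ hammingNorm y := by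
    intro v
    obtain ⟨x, hx, hmin⟩ := Set.exists_min_image {x : Word n | H *ᵥ x = v} hammingNorm
      (Set.toFinite _) (hH v)
    exact ⟨x, hx, hmin⟩
  choose f hf using this
  exact ⟨f, hf⟩

theorem IsCosetLeaderMap.hammingNorm_le {m n : ℕ} {H : Matrix (Fin m) (Fin n) (ZMod 2)}
    {f : Word m → Word n} (hf : IsCosetLeaderMap H f) {r : ℝ}
    (hH : ∀ v, ∃ x : Word n, (hammingNorm x : ℝ) ≤ r ∧ H *ᵥ x = v) (v : Word m) :
    (hammingNorm (f v) : ℝ) ≤ r := by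
  obtain ⟨x, hx, hv⟩ := hH v
  exact le_trans (by exact_mod_cast (hf v).2 x hv) hx

theorem coveringRadiusLE_of_forall_exists {m n : ℕ} {H : Matrix (Fin m) (Fin n) (ZMod 2)} {r : ℝ}
    (hH : ∀ v, ∃ x : Word n, (hammingNorm x : ℝ) ≤ r ∧ H *ᵥ x = v) : CoveringRadiusLE H r := by
  intro s
  obtain ⟨x, hx, hv⟩ := hH (H *ᵥ s)
  refine ⟨s + x, by rw [Matrix.mulVec_add, hv, word_add_self], ?_⟩
  rwa [hammingDist_eq_hammingNorm, neg_add_cancel_left]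

/-! ### Error probability -/

theorem stateProb_eq {n : ℕ} (s : Word n) : stateProb s = 1 / 2 ^ n := by
  simp [stateProb]

section Code

variable {n : ℕ} {W₁ W₂ : Type}

theorem Code.errorProb_eq_zero [Fintype W₁] [Fintype W₂] [DecidableEq W₁] [DecidableEq W₂]
    (C : Code n W₁ W₂)
    (h : ∀ w₁ w₂ s₁ s₂, C.dec (C.output w₁ w₂ s₁ s₂) = (w₁, w₂)) : C.errorProb = 0 := by
  simp [Code.errorProb, h]

theorem Code.swap_output (C : Code n W₁ W₂) (w₁ : W₁) (w₂ : W₂) (s₁ s₂ : Word n) :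
    C.swap.output w₂ w₁ s₂ s₁ = C.output w₁ w₂ s₁ s₂ := by
  simp only [Code.output, Code.swap, channel]
  abel

theorem Code.swap_dec_eq_iff (C : Code n W₁ W₂) (y : Word n) (w₁ : W₁) (w₂ : W₂) :
    C.swap.dec y = (w₂, w₁) ↔ C.dec y = (w₁, w₂) :=
  Prod.swap_injective.eq_iff (a := C.dec y) (b := (w₁, w₂))

theorem Code.InputConstraint.swap {C : Code n W₁ W₂} {q₁ q₂ : ℝ} (h : C.InputConstraint q₁ q₂) :
    C.swap.InputConstraint q₂ q₁ :=
  ⟨h.2, h.1⟩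

variable [Fintype W₁] [Fintype W₂] [DecidableEq W₁] [DecidableEq W₂]

theorem Code.errorProb_swap (C : Code n W₁ W₂) : C.swap.errorProb = C.errorProb := by
  rw [Code.errorProb, Code.errorProb, Finset.sum_comm]
  refine Finset.sum_congr rfl fun w₁ _ => Finset.sum_congr rfl fun w₂ _ => ?_
  rw [Finset.sum_comm]
  refine Finset.sum_congr rfl fun s₁ _ => Finset.sum_congr rfl fun s₂ _ => ?_
  rw [C.swap_output]
  simp only [C.swap_dec_eq_iff, stateProb_eq]
  ring

/-- The number of correctly decoded configurations. -/
def Code.correctCount (C : Code n W₁ W₂) : ℕ :=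
  ∑ w₁ : W₁, ∑ w₂ : W₂, ∑ s₂ : Word n,
    (Finset.univ.filter fun s₁ => C.dec (C.output w₁ w₂ s₁ s₂) = (w₁, w₂)).card

/-- All configurations of messages and interference are equally likely, so the success probability
is a ratio of counts. -/
theorem Code.one_sub_errorProb [Nonempty W₁] [Nonempty W₂] (C : Code n W₁ W₂) :
    1 - C.errorProb =
      C.correctCount / (Fintype.card W₁ * Fintype.card W₂ * (2 ^ n * 2 ^ n)) := by
  have h1 : (Fintype.card W₁ : ℝ) ≠ 0 := by exact_mod_cast Fintype.card_ne_zero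
  have h2 : (Fintype.card W₂ : ℝ) ≠ 0 := by exact_mod_cast Fintype.card_ne_zero
  set a : ℝ := (Fintype.card W₁ * Fintype.card W₂ * (2 ^ n * 2 ^ n))⁻¹ with ha
  have hone : (1 : ℝ) = ∑ w₁ : W₁, ∑ w₂ : W₂, ∑ s₁ : Word n, ∑ s₂ : Word n, a := by
    simp only [Finset.sum_const, Finset.card_univ, card_word, nsmul_eq_mul, ha]
    push_cast
    field_simp
  have hcount : (C.correctCount : ℝ) = ∑ w₁ : W₁, ∑ w₂ : W₂, ∑ s₁ : Word n, ∑ s₂ : Word n,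
      (if C.dec (C.output w₁ w₂ s₁ s₂) = (w₁, w₂) then 1 else 0) := by
    simp only [Code.correctCount, Finset.card_filter]
    push_cast
    refine Finset.sum_congr rfl fun w₁ _ => Finset.sum_congr rfl fun w₂ _ => ?_
    rw [Finset.sum_comm]
  rw [div_eq_mul_inv, ← ha, hcount]
  conv_lhs => rw [hone]
  simp only [Code.errorProb, Finset.sum_mul, ← Finset.sum_sub_distrib, stateProb_eq]
  refine Finset.sum_congr rfl fun w₁ _ => Finset.sum_congr rfl fun w₂ _ =>
    Finset.sum_congr rfl fun s₁ _ => Finset.sum_congr rfl fun s₂ _ => ?_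
  split_ifs
  · ring
  · rw [ha]
    field_simp
    ring

/-- For fixed messages and second interference word, the first interference word is determined
by the channel input of the first user and the channel output. -/
theorem Code.correctCount_le (C : Code n W₁ W₂) {r : ℝ}
    (h : ∀ w₁ s₁, (hammingNorm (C.enc₁ w₁ s₁) : ℝ) ≤ r) :
    C.correctCount ≤ 2 ^ n * 2 ^ n * (ball n r).card := by
  have key : ∀ w₁ w₂ s₂,
      (Finset.univ.filter fun s₁ => C.dec (C.output w₁ w₂ s₁ s₂) = (w₁, w₂)).card ≤
        (ball n r).card * (Finset.univ.filter fun y => C.dec y = (w₁, w₂)).card := by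
    intro w₁ w₂ s₂
    rw [← Finset.card_product]
    refine Finset.card_le_card_of_injOn
      (fun s₁ => (C.enc₁ w₁ s₁, C.output w₁ w₂ s₁ s₂)) ?_ ?_
    · intro s₁ hs
      have hs' : C.dec (C.output w₁ w₂ s₁ s₂) = (w₁, w₂) := by simpa using hs
      simp [h, hs']
    · intro s _ s' _ hss
      obtain ⟨e1, e2⟩ := Prod.mk.inj hss
      simp only [Code.output, channel, e1] at e2
      exact add_left_cancel (add_right_cancel e2)
  -- The fibres of the decoder partition the output words.
  have hD : ∑ w₁ : W₁, ∑ w₂ : W₂, (Finset.univ.filter fun y => C.dec y = (w₁, w₂)).card =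
      2 ^ n := by
    rw [← card_word, ← Finset.card_univ,
      Finset.card_eq_sum_card_fiberwise (f := C.dec) (t := Finset.univ) (by simp),
      Fintype.sum_prod_type]
  calc C.correctCount ≤ ∑ w₁ : W₁, ∑ w₂ : W₂, ∑ _s₂ : Word n,
        (ball n r).card * (Finset.univ.filter fun y => C.dec y = (w₁, w₂)).card :=
        Finset.sum_le_sum fun w₁ _ => Finset.sum_le_sum fun w₂ _ =>
          Finset.sum_le_sum fun s₂ _ => key w₁ w₂ s₂
    _ = 2 ^ n * 2 ^ n * (ball n r).card := by
        simp only [Finset.sum_const, Finset.card_univ, card_word, smul_eq_mul, ← Finset.mul_sum,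
          hD]
        ring

/-- A strong converse: the correct decoding probability is at most the ratio of the number of
admissible inputs of the first user to the number of message pairs. -/
theorem Code.one_sub_errorProb_mul_le [Nonempty W₁] [Nonempty W₂] (C : Code n W₁ W₂) {r : ℝ}
    (h : ∀ w₁ s₁, (hammingNorm (C.enc₁ w₁ s₁) : ℝ) ≤ r) :
    (1 - C.errorProb) * (Fintype.card W₁ * Fintype.card W₂) ≤ (ball n r).card := by
  have h1 : (0 : ℝ) < Fintype.card W₁ := by exact_mod_cast Fintype.card_pos
  have h2 : (0 : ℝ) < Fintype.card W₂ := by exact_mod_cast Fintype.card_pos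
  have h3 : (C.correctCount : ℝ) ≤ 2 ^ n * 2 ^ n * (ball n r).card := by
    exact_mod_cast C.correctCount_le h
  rw [C.one_sub_errorProb, div_mul_eq_mul_div, div_le_iff₀ (by positivity)]
  nlinarith [mul_le_mul_of_nonneg_right h3 (mul_pos h1 h2).le]

end Code

/-! ### The converse -/

theorem Achievable.swap {q₁ q₂ : ℝ} {R : ℝ × ℝ} (h : Achievable q₁ q₂ R) :
    Achievable q₂ q₁ R.swap := by
  obtain ⟨h1, h2, M₁, M₂, C, hM, hR, hC, hE⟩ := h
  exact ⟨h2, h1, M₂, M₁, fun n => (C n).swap, fun n => (hM n).symm, fun n hn => (hR n hn).symm,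
    fun n => (hC n).swap, by simpa only [Code.errorProb_swap] using hE⟩

/-- Error probability below 1/2 already suffices: the resulting factor 2 costs one bit, that is `1 /
n` in the sum rate, which vanishes in the limit. -/
theorem Achievable.add_le_Hb {q₁ q₂ : ℝ} (hq₁ : 0 ≤ q₁ ∧ q₁ ≤ 1 / 2) {R : ℝ × ℝ}
    (h : Achievable q₁ q₂ R) : R.1 + R.2 ≤ Hb q₁ := by
  obtain ⟨-, -, M₁, M₂, C, hM, hR, hC, hE⟩ := h
  have hlim : Tendsto (fun n : ℕ => Hb q₁ + 1 / (n : ℝ)) atTop (𝓝 (Hb q₁)) := by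
    simpa using (tendsto_const_nhds (x := Hb q₁)).add
      (tendsto_one_div_atTop_nhds_zero_nat (𝕜 := ℝ))
  refine ge_of_tendsto hlim ?_
  filter_upwards [hE.eventually (gt_mem_nhds (show (0 : ℝ) < 1 / 2 by norm_num)),
    eventually_gt_atTop 0] with n hn hpos
  have hpos' : (0 : ℝ) < n := by exact_mod_cast hpos
  obtain ⟨r1, r2⟩ := hR n hpos
  have m1 : (0 : ℝ) < M₁ n := by exact_mod_cast (hM n).1
  have m2 : (0 : ℝ) < M₂ n := by exact_mod_cast (hM n).2
  have : Nonempty (Fin (M₁ n)) := ⟨⟨0, (hM n).1⟩⟩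
  have : Nonempty (Fin (M₂ n)) := ⟨⟨0, (hM n).2⟩⟩
  have hb := (C n).one_sub_errorProb_mul_le (r := n * q₁) fun w s => by
    have := (hC n).1 w s
    rwa [div_le_iff₀ hpos', mul_comm] at this
  have hc := hb.trans (card_ball_le hq₁.1 hq₁.2)
  rw [Fintype.card_fin, Fintype.card_fin] at hc
  have hd : (M₁ n : ℝ) * M₂ n ≤ 2 ^ (n * Hb q₁ + 1) := by
    rw [Real.rpow_add two_pos, Real.rpow_one]
    nlinarith [mul_pos m1 m2]
  have hl := (Real.logb_le_iff_le_rpow one_lt_two (mul_pos m1 m2)).2 hd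
  rw [Real.logb_mul m1.ne' m2.ne'] at hl
  simp only [rate, Fintype.card_fin] at r1 r2
  have : (Real.logb 2 (M₁ n) + Real.logb 2 (M₂ n)) / n ≤ Hb q₁ + 1 / n := by
    rw [div_le_iff₀ hpos', add_mul, div_mul_cancel₀ _ hpos'.ne']
    linarith
  rw [add_div] at this
  linarith

/-! ### Syndrome coding -/

/-- Both users send coset leaders; the sum of the syndromes they encode is received. -/
theorem mulVec_channel_cosetLeader {m n : ℕ} {H : Matrix (Fin m) (Fin n) (ZMod 2)}
    {f : Word m → Word n} (hf : IsCosetLeaderMap H f) (v₁ v₂ : Word m) (s₁ s₂ : Word n) :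
    H *ᵥ channel (f (v₁ + H *ᵥ s₁)) (f (v₂ + H *ᵥ s₂)) s₁ s₂ = v₁ + v₂ := by
  simp only [channel, Matrix.mulVec_add, (hf _).1]
  calc _ = v₁ + v₂ + (H *ᵥ s₁ + H *ᵥ s₁) + (H *ᵥ s₂ + H *ᵥ s₂) := by abel
    _ = v₁ + v₂ := by rw [word_add_self, word_add_self, add_zero, add_zero]

theorem syndromeCode_errorProb {m n : ℕ} {H : Matrix (Fin m) (Fin n) (ZMod 2)}
    {f : Word m → Word n} (hf : IsCosetLeaderMap H f) : (syndromeCode H f).errorProb = 0 := by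
  refine Code.errorProb_eq_zero _ fun v w s₁ s₂ => ?_
  have h := mulVec_channel_cosetLeader hf v 0 s₁ s₂
  rw [zero_add, add_zero] at h
  exact Prod.ext h rfl

theorem syndromeCode_inputConstraint {m n : ℕ} {H : Matrix (Fin m) (Fin n) (ZMod 2)}
    {f : Word m → Word n} {q₁ q₂ : ℝ} (h₁ : ∀ v, (hammingNorm (f v) : ℝ) / n ≤ q₁)
    (h₂ : ∀ v, (hammingNorm (f v) : ℝ) / n ≤ q₂) : (syndromeCode H f).InputConstraint q₁ q₂ :=
  ⟨fun _ _ => h₁ _, fun _ _ => h₂ _⟩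

/-- The syndrome can be shared between the two users in any proportion. -/
theorem exists_code_of_cosetLeader {m n k₁ k₂ : ℕ} {H : Matrix (Fin m) (Fin n) (ZMod 2)}
    {f : Word m → Word n} (hf : IsCosetLeaderMap H f) (hk : k₁ + k₂ ≤ m) {q₁ q₂ : ℝ}
    (h₁ : ∀ v, (hammingNorm (f v) : ℝ) / n ≤ q₁) (h₂ : ∀ v, (hammingNorm (f v) : ℝ) / n ≤ q₂) :
    ∃ C : Code n (Fin (2 ^ k₁)) (Fin (2 ^ k₂)), C.InputConstraint q₁ q₂ ∧ C.errorProb = 0 := by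
  -- The users encode `g (w₁, 0)` and `g (0, w₂)`; by linearity the received syndrome is `g (w₁,
  -- w₂)`, and injectivity recovers both messages.
  obtain ⟨g, hg⟩ : ∃ g : (Word k₁ × Word k₂) →ₗ[ZMod 2] Word m, Function.Injective g := by
    rw [← finrank_le_iff_exists_linearMap]
    simpa [Module.finrank_prod] using hk
  let e₁ : Fin (2 ^ k₁) ≃ Word k₁ := (Fintype.equivFinOfCardEq (card_word k₁)).symm
  let e₂ : Fin (2 ^ k₂) ≃ Word k₂ := (Fintype.equivFinOfCardEq (card_word k₂)).symm
  refine ⟨{ enc₁ := fun w s => f (g (e₁ w, 0) + H *ᵥ s)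
            enc₂ := fun w s => f (g (0, e₂ w) + H *ᵥ s)
            dec := fun y => Prod.map e₁.symm e₂.symm (Function.invFun g (H *ᵥ y)) },
    ⟨fun _ _ => h₁ _, fun _ _ => h₂ _⟩, Code.errorProb_eq_zero _ fun w₁ w₂ s₁ s₂ => ?_⟩
  simp only [Code.output]
  rw [mulVec_channel_cosetLeader hf, ← map_add, Prod.mk_add_mk, add_zero, zero_add,
    Function.leftInverse_invFun hg]
  simp

/-! ### Achievability -/

theorem eventually_exists_cosetLeaderMap {q : ℝ} (h0 : 0 ≤ q) (h1 : q ≤ 1 / 2) {ε : ℝ}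
    (hε : 0 < ε) :
    ∀ᶠ n : ℕ in atTop, ∃ (m : ℕ) (H : Matrix (Fin m) (Fin n) (ZMod 2)) (f : Word m → Word n),
      IsCosetLeaderMap H f ∧ CoveringRadiusLE H (n * q) ∧ Hb q - ε ≤ m / n ∧
        ∀ v, (hammingNorm (f v) : ℝ) / n ≤ q := by
  filter_upwards [eventually_exists_parityCheck h0 h1 hε, eventually_gt_atTop 0] with n hn hpos
  have hpos' : (0 : ℝ) < n := by exact_mod_cast hpos
  obtain ⟨m, H, hm, hH⟩ := hn
  obtain ⟨f, hf⟩ := exists_isCosetLeaderMap fun v => (hH v).imp fun _ h => h.2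
  refine ⟨m, H, f, hf, coveringRadiusLE_of_forall_exists hH, hm, fun v => ?_⟩
  rw [div_le_iff₀ hpos', mul_comm]
  exact hf.hammingNorm_le hH v

theorem rate_fin_two_pow (n k : ℕ) : rate n (Fin (2 ^ k)) = k / n := by
  simp [rate, Real.logb_pow]

theorem rate_word (n m : ℕ) : rate n (Word m) = m / n := by
  rw [rate, card_word]
  simp [Real.logb_pow]

/-- Filler for the finitely many short block lengths, where achievability still asks for a code of
the right rates but its error is irrelevant. -/
theorem exists_code_inputConstraint {n : ℕ} {q₁ q₂ : ℝ} (hq₁ : 0 ≤ q₁) (hq₂ : 0 ≤ q₂) (k₁ k₂ : ℕ) :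
    ∃ C : Code n (Fin (2 ^ k₁)) (Fin (2 ^ k₂)), C.InputConstraint q₁ q₂ :=
  ⟨{ enc₁ := fun _ _ => 0
     enc₂ := fun _ _ => 0
     dec := fun _ => (⟨0, by positivity⟩, ⟨0, by positivity⟩) },
    fun _ _ => by simpa using hq₁, fun _ _ => by simpa using hq₂⟩

theorem achievable_of_add_lt {q₁ q₂ : ℝ} (hq₁ : 0 ≤ q₁ ∧ q₁ ≤ 1 / 2) (hq₂ : 0 ≤ q₂ ∧ q₂ ≤ 1 / 2)
    {R : ℝ × ℝ} (h1 : 0 ≤ R.1) (h2 : 0 ≤ R.2) (h : R.1 + R.2 < Hb (min q₁ q₂)) :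
    Achievable q₁ q₂ R := by
  -- Half of the slack is given to the covering code; the other half, once `n ≥ 2 / ε`, pays for
  -- rounding up the two message lengths.
  set ε := (Hb (min q₁ q₂) - (R.1 + R.2)) / 2 with hε
  have hε0 : 0 < ε := by
    rw [hε]
    linarith
  have hgood : ∀ᶠ n : ℕ in atTop,
      ∃ C : Code n (Fin (2 ^ ⌈n * R.1⌉₊)) (Fin (2 ^ ⌈n * R.2⌉₊)),
        C.InputConstraint q₁ q₂ ∧ C.errorProb = 0 := by
    filter_upwards [eventually_exists_cosetLeaderMap (le_min hq₁.1 hq₂.1)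
      ((min_le_left _ _).trans hq₁.2) hε0, eventually_gt_atTop 0,
      tendsto_natCast_atTop_atTop.eventually_ge_atTop (2 / ε)] with n hn hpos hbig
    obtain ⟨m, H, f, hf, -, hm, hw⟩ := hn
    have hpos' : (0 : ℝ) < n := by exact_mod_cast hpos
    refine exists_code_of_cosetLeader hf ?_ (fun v => (hw v).trans (min_le_left _ _))
      fun v => (hw v).trans (min_le_right _ _)
    have c1 := (Nat.ceil_lt_add_one (show 0 ≤ n * R.1 by positivity)).le
    have c2 := (Nat.ceil_lt_add_one (show 0 ≤ n * R.2 by positivity)).le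
    rw [div_le_iff₀ hε0] at hbig
    rw [le_div_iff₀ hpos'] at hm
    have : ((⌈n * R.1⌉₊ + ⌈n * R.2⌉₊ : ℕ) : ℝ) ≤ m := by
      push_cast
      have e : (Hb (min q₁ q₂) - ε) * n = n * R.1 + n * R.2 + n * ε := by
        rw [hε]
        ring
      linarith
    exact_mod_cast this
  obtain ⟨N, hN⟩ := eventually_atTop.1 hgood
  have hex : ∀ n : ℕ, ∃ C : Code n (Fin (2 ^ ⌈n * R.1⌉₊)) (Fin (2 ^ ⌈n * R.2⌉₊)),
      C.InputConstraint q₁ q₂ ∧ (N ≤ n → C.errorProb = 0) := by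
    intro n
    by_cases hn : N ≤ n
    · exact (hN n hn).imp fun C hC => ⟨hC.1, fun _ => hC.2⟩
    · exact (exists_code_inputConstraint hq₁.1 hq₂.1 _ _).imp fun C hC => ⟨hC, fun h => absurd h hn⟩
  choose C hC hE using hex
  refine ⟨h1, h2, _, _, C, fun n => ⟨by positivity, by positivity⟩, fun n hn => ?_, hC, ?_⟩
  · have hn' : (0 : ℝ) < n := by exact_mod_cast hn
    rw [rate_fin_two_pow, rate_fin_two_pow, le_div_iff₀ hn', le_div_iff₀ hn', mul_comm R.1,
      mul_comm R.2]
    exact ⟨Nat.le_ceil _, Nat.le_ceil _⟩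
  · refine tendsto_const_nhds.congr' ?_
    filter_upwards [eventually_ge_atTop N] with n hn
    exact (hE n hn).symm

/-- Needed when `Hb (min q₁ q₂) = 0`, where no pair has sum rate strictly below the bound. -/
theorem achievable_zero {q₁ q₂ : ℝ} (hq₁ : 0 ≤ q₁) (hq₂ : 0 ≤ q₂) : Achievable q₁ q₂ 0 := by
  refine ⟨le_rfl, le_rfl, fun _ => 1, fun _ => 1,
    fun n => { enc₁ := fun _ _ => 0, enc₂ := fun _ _ => 0, dec := fun _ => (0, 0) },
    fun n => ⟨one_pos, one_pos⟩, fun n _ => by simp [rate],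
    fun n => ⟨fun _ _ => by simpa using hq₁, fun _ _ => by simpa using hq₂⟩, ?_⟩
  refine tendsto_const_nhds.congr fun n => (Code.errorProb_eq_zero _ fun w₁ w₂ s₁ s₂ => ?_).symm
  exact Subsingleton.elim _ _

theorem mem_capacityRegion {q₁ q₂ : ℝ} (hq₁ : 0 ≤ q₁ ∧ q₁ ≤ 1 / 2) (hq₂ : 0 ≤ q₂ ∧ q₂ ≤ 1 / 2)
    {R : ℝ × ℝ} (h1 : 0 ≤ R.1) (h2 : 0 ≤ R.2) (h : R.1 + R.2 ≤ Hb (min q₁ q₂)) :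
    R ∈ capacityRegion q₁ q₂ := by
  rcases (add_nonneg h1 h2).eq_or_lt with h0 | h0
  · have : R = 0 := Prod.ext (by simp only [Prod.fst_zero]; linarith)
      (by simp only [Prod.snd_zero]; linarith)
    rw [this]
    exact subset_closure (achievable_zero hq₁.1 hq₂.1)
  -- With a positive sum rate, `t • R` lies strictly below the bound for `0 < t < 1` and tends to
  -- `R` as `t` increases to 1.
  · have hlim : Tendsto (fun t : ℝ => t • R) (𝓝[<] 1) (𝓝 R) := by
      have : Tendsto (fun t : ℝ => t • R) (𝓝 1) (𝓝 ((1 : ℝ) • R)) :=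
        (continuous_id.smul continuous_const).tendsto 1
      rw [one_smul] at this
      exact this.mono_left nhdsWithin_le_nhds
    refine mem_closure_of_tendsto hlim ?_
    filter_upwards [self_mem_nhdsWithin,
      nhdsWithin_le_nhds (lt_mem_nhds (show (0 : ℝ) < 1 by norm_num))] with t ht1 ht0
    have ht1' : t < 1 := ht1
    refine achievable_of_add_lt hq₁ hq₂ (mul_nonneg ht0.le h1) (mul_nonneg ht0.le h2) ?_
    simp only [Prod.smul_fst, Prod.smul_snd, smul_eq_mul]
    nlinarith

/-- The capacity region of the binary doubly-dirty multiple access channel. -/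
theorem capacityRegion_eq {q₁ q₂ : ℝ} (hq₁ : 0 ≤ q₁ ∧ q₁ ≤ 1 / 2) (hq₂ : 0 ≤ q₂ ∧ q₂ ≤ 1 / 2) :
    capacityRegion q₁ q₂ =
      {R : ℝ × ℝ | 0 ≤ R.1 ∧ 0 ≤ R.2 ∧ R.1 + R.2 ≤ min (Hb q₁) (Hb q₂)} := by
  refine Set.Subset.antisymm (closure_minimal ?_ ?_) ?_
  · intro R hR
    refine ⟨hR.1, hR.2.1, le_min (hR.add_le_Hb hq₁) ?_⟩
    rw [add_comm]
    exact hR.swap.add_le_Hb hq₂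
  · exact (isClosed_le continuous_const continuous_fst).inter
      ((isClosed_le continuous_const continuous_snd).inter
        (isClosed_le (continuous_fst.add continuous_snd) continuous_const))
  · rintro R ⟨h1, h2, h⟩
    rw [min_Hb hq₁ hq₂] at h
    exact mem_capacityRegion hq₁ hq₂ h1 h2 h

end DirtyMAC

theorem theorem1 (q₁ q₂ : ℝ) (hq₁ : 0 ≤ q₁ ∧ q₁ ≤ 1 / 2) (hq₂ : 0 ≤ q₂ ∧ q₂ ≤ 1 / 2) :
    DirtyMAC.capacityRegion q₁ q₂ =
      {R : ℝ × ℝ | 0 ≤ R.1 ∧ 0 ≤ R.2 ∧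
        R.1 + R.2 ≤ min (DirtyMAC.Hb q₁) (DirtyMAC.Hb q₂)} ∧
    ∀ ε : ℝ, 0 < ε → ∀ᶠ n : ℕ in Filter.atTop,
      ∃ (m : ℕ) (H : Matrix (Fin m) (Fin n) (ZMod 2))
        (f : DirtyMAC.Word m → DirtyMAC.Word n),
        DirtyMAC.IsCosetLeaderMap H f ∧
        DirtyMAC.CoveringRadiusLE H (n * min q₁ q₂) ∧
        min (DirtyMAC.Hb q₁) (DirtyMAC.Hb q₂) - ε ≤ DirtyMAC.rate n (DirtyMAC.Word m) ∧
        (DirtyMAC.syndromeCode H f).InputConstraint q₁ q₂ ∧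
        (DirtyMAC.syndromeCode H f).errorProb = 0 ∧
        (DirtyMAC.syndromeCode H f).swap.InputConstraint q₁ q₂ ∧
        (DirtyMAC.syndromeCode H f).swap.errorProb = 0 := by
  refine ⟨DirtyMAC.capacityRegion_eq hq₁ hq₂, fun ε hε => ?_⟩
  filter_upwards [DirtyMAC.eventually_exists_cosetLeaderMap (le_min hq₁.1 hq₂.1)
    ((min_le_left _ _).trans hq₁.2) hε] with n hn
  obtain ⟨m, H, f, hf, hcov, hm, hw⟩ := hn
  have w₁ : ∀ v, (hammingNorm (f v) : ℝ) / n ≤ q₁ := fun v => (hw v).trans (min_le_left _ _)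
  have w₂ : ∀ v, (hammingNorm (f v) : ℝ) / n ≤ q₂ := fun v => (hw v).trans (min_le_right _ _)
  have he := DirtyMAC.syndromeCode_errorProb hf
  -- Exchanging the users also exchanges the constraints, so the swapped code starts from the
  -- constraints in the order `q₂`, `q₁`.
  refine ⟨m, H, f, hf, hcov, ?_, DirtyMAC.syndromeCode_inputConstraint w₁ w₂, he,
    (DirtyMAC.syndromeCode_inputConstraint w₂ w₁).swap, ?_⟩
  · rwa [DirtyMAC.rate_word, DirtyMAC.min_Hb hq₁ hq₂]
  · rw [DirtyMAC.Code.errorProb_swap, he]
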